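/- For a finite connected graph $G$, the eccentric sequence of $G$ is the nondecreasing sequence of the eccentricities of its vertices; a sequence $S$ of positive integers is a tree eccentric sequence if it is the eccentric sequence of some tree. If $b_1<b_2<\dots<b_l$ are the distinct terms of such a sequence $S$, and $b_j$ occurs $m_j$ times in $S$, write $S=(r;m_2,\dots,m_l)$ with $r=b_1$. Let $\mathbf{T}(r;m_2,\dots,m_l)$ be the tree obtained from the path $v_0,v_1,\dots,v_{r+l-1}$ by attaching $m_j-2$ pendent edges to the vertex $v_{l+1-j}$ for every $2\le j\le l$. For $\lambda\in\mathbb{R}$ let $W^{\lambda}(G)=\sum_{\{u,v\}\subset V(G)} d(u,v)^{\lambda}$ be the generalised Wiener index, and let $H(G)=\sum_{\{u,v\}\subset V(G)} \frac{1}{d(u,v)}$ be the Harary index, the sums being over all unordered pairs of distinct vertices. Corollary 2. Let $S=(r;m_2,\dots,m_l)$ be a tree eccentric sequence. Then $\mathbf{T}(r;m_2,\dots,m_l)$ is a tree with eccentric sequence $S$, and for every $\lambda<0$ it is, up to isomorphism, the unique maximiser of $W^{\lambda}$ among all trees with eccentric sequence $S$: every tree $T$ with eccentric sequence $S$ satisfies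 $W^{\lambda}(T)\le W^{\lambda}(\mathbf{T}(r;m_2,\dots,m_l))$, with equality if and only if $T$ is isomorphic to $\mathbf{T}(r;m_2,\dots,m_l)$. In particular, $\mathbf{T}(r;m_2,\dots,m_l)$ is, up to isomorphism, the unique maximiser of the Harary index $H$ among all trees with eccentric sequence $S$. -/

import Mathlib

/-- The eccentric sequence of a finite (connected) graph: the nondecreasing sequence of the
eccentricities of its vertices. -/
noncomputable def eccentricSequence {V : Type*} [Fintype V] (G : SimpleGraph V) : List ℕ :=
  ((Finset.univ : Finset V).val.map fun v => (G.eccent v).toNat).sort (· ≤ ·)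

/-- A sequence of positive integers is a tree eccentric sequence if it is the eccentric sequence
of some finite tree. -/
def IsTreeEccentricSequence (S : List ℕ) : Prop :=
  (∀ a ∈ S, 0 < a) ∧
    ∃ (n : ℕ) (T : SimpleGraph (Fin n)), T.IsTree ∧ eccentricSequence T = S

/-- `S = (r; m₂, …, m_l)` for a nondecreasing sequence `S`: if `b₁ < b₂ < ⋯ < b_l` are the distinct
terms of `S`, then `r = b₁`, and `m` is the list of the multiplicities of `b₂, …, b_l` in `S`. -/
def HasShorthand (S : List ℕ) (r : ℕ) (m : List ℕ) : Prop :=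
  S.head? = some r ∧ S.dedup.tail.map (fun b => S.count b) = m

/-- Vertices of `𝐓(r; m₂, …, m_l)`: the path vertices `v₀, …, v_{r+l-1}` and, for each `j` with
`2 ≤ j ≤ l`, a set of `m_j - 2` further vertices. The list `m` has length `l - 1` and
its entry at position `i` is `m_{i+2}`. -/
abbrev StandardTreeVertex (r : ℕ) (m : List ℕ) : Type :=
  Fin (r + m.length + 1) ⊕ (Σ i : Fin m.length, Fin (m.get i - 2))

/-- The tree `𝐓(r; m₂, …, m_l)`: the path `v₀, …, v_{r+l-1}` with `m_j - 2` pendent edges attached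
to `v_{l+1-j}` for all `2 ≤ j ≤ l`. With `j = i + 2` and `l = m.length + 1`, the index `l + 1 - j`
is `m.length - i`. -/
def standardTree (r : ℕ) (m : List ℕ) : SimpleGraph (StandardTreeVertex r m) where
  Adj
    | .inl a, .inl b => a.val + 1 = b.val ∨ b.val + 1 = a.val
    | .inl a, .inr p => a.val = m.length - p.1.val
    | .inr p, .inl a => a.val = m.length - p.1.val
    | .inr _, .inr _ => False
  symm := ⟨by
    rintro (a | p) (b | q) h
    · exact Or.symm h
    · exact h
    · exact h
    · exact h⟩
  loopless := ⟨by
    rintro (a | p) h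
    · rcases h with h | h <;> omega
    · exact h⟩

open Classical in
/-- The Wiener-type index `W(G; g)`: the sum of `g (d(u,v))` over all unordered pairs `{u, v}` of
distinct vertices. -/
noncomputable def wienerTypeIndex {V : Type*} [Fintype V] (G : SimpleGraph V) (g : ℕ → ℝ) : ℝ :=
  ∑ e : Sym2 V with ¬ e.IsDiag,
    Sym2.lift ⟨fun u v => g (G.dist u v), fun _ _ => congrArg g SimpleGraph.dist_comm⟩ e

/-- The generalised Wiener index `W^lam(G) = ∑ d(u,v)^lam`. -/
noncomputable def generalisedWienerIndex {V : Type*} [Fintype V] (lam : ℝ)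
    (G : SimpleGraph V) : ℝ :=
  wienerTypeIndex G fun d => (d : ℝ) ^ lam

/-- The Harary index `H(G) = ∑ 1 / d(u,v)`. -/
noncomputable def hararyIndex {V : Type*} [Fintype V] (G : SimpleGraph V) : ℝ :=
  wienerTypeIndex G fun d => 1 / (d : ℝ)

/-! Fix a diametral path `p 0, …, p D` of a tree. Every vertex `v` reaches the path through a gate
`p k`, at some height `h` above it, and this gives `ecc v = h + max k (D - k)` (`exists_gate`,
`ecc_of_gate`). Pairs inside the path contribute the same in all trees of diameter `D`. Every other
pair is charged to an endpoint off the path, the one of larger eccentricity if both are off it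
(`sum_sum_pairWeight`).

Let `v` be off the path, of eccentricity `t`, with gate in the first half. On a level `s < t` with
`D < 2 * s`, one vertex (the ancestor of `v` towards `p D`) is at distance `t - s`, `p s` is at
distance `s + t - D`, and all others are at distance at least `t - s + 2`. Other off-path vertices
of level `t` are at distance at least 2, and the path vertices of levels `s ≥ t` are at distances `s
+ t - D` and `s - t + 2 * h`. For decreasing `g` the charge is thus bounded in terms of `D`, `t` and
the level sizes (`offWeight_le`). As the eccentric sequence determines `D`, the sum of these bounds
is common to all competitors.

Equality means that all off-path vertices are tight, which holds in the standard tree. Conversely,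
tight vertices cannot hang strictly on both sides of the middle (`not_opposite`), so they all hang
on one half at positions dictated by their eccentricities, which is the standard tree. Only strict
decrease of `g` on positive distances is used. -/

namespace EccentricTree

open Finset

section Distances

variable {V : Type*} {T : SimpleGraph V}

/-! ### Distances in trees -/

theorem exists_dist_split (hc : T.Connected) {x y : V} {n : ℕ} (hn : n ≤ T.dist x y) :
    ∃ w, T.dist x w = n ∧ n + T.dist w y = T.dist x y := by
  obtain ⟨q, hq⟩ := hc.exists_walk_length_eq_dist x y
  have h1 : T.dist x (q.getVert n) ≤ n :=
    (SimpleGraph.dist_le (q.take n)).trans (by simp [SimpleGraph.Walk.take_length])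
  have h2 : T.dist (q.getVert n) y ≤ T.dist x y - n :=
    (SimpleGraph.dist_le (q.drop n)).trans (by simp [SimpleGraph.Walk.drop_length, hq])
  have h3 := hc.dist_triangle (u := x) (v := q.getVert n) (w := y)
  exact ⟨q.getVert n, by omega, by omega⟩

theorem eq_of_dist_split (hT : T.IsTree) {x y w w' : V}
    (hw : T.dist x w + T.dist w y = T.dist x y) (hw' : T.dist x w' + T.dist w' y = T.dist x y)
    (h : T.dist x w = T.dist x w') : w = w' := by
  have key : ∀ z, T.dist x z + T.dist z y = T.dist x y →
      ∃ q : T.Walk x y, q.IsPath ∧ q.getVert (T.dist x z) = z := by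
    intro z hz
    obtain ⟨a, ha⟩ := hT.connected.exists_walk_length_eq_dist x z
    obtain ⟨b, hb⟩ := hT.connected.exists_walk_length_eq_dist z y
    refine ⟨a.append b, (a.append b).isPath_of_length_eq_dist ?_, ?_⟩
    · rw [SimpleGraph.Walk.length_append]; omega
    · rw [SimpleGraph.Walk.getVert_append]; simp [ha]
  obtain ⟨q, hq, hqw⟩ := key w hw
  obtain ⟨q', hq', hqw'⟩ := key w' hw'
  have : q = q' := (hT.existsUnique_path x y).unique hq hq'
  rw [← hqw, ← hqw', this, h]

/-- Induction on the distance from `x` to `u`. A step from `u'` to `u` away from `x` changes the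
distance to `y` by exactly one; the median stays put unless `u'` is the median and the step goes
towards `y`, in which case it becomes `u`. -/
theorem exists_median (hT : T.IsTree) (x y u : V) :
    ∃ w, T.dist x w + T.dist w y = T.dist x y ∧ T.dist u w + T.dist w x = T.dist u x ∧
      T.dist u w + T.dist w y = T.dist u y := by
  have hc := hT.connected
  have tri := fun a b c => hc.dist_triangle (u := a) (v := b) (w := c)
  have cm := fun a b => SimpleGraph.dist_comm (G := T) (u := a) (v := b)
  induction hn : T.dist x u generalizing u with
  | zero =>
    obtain rfl := hc.dist_eq_zero_iff.1 hn
    exact ⟨x, by simp⟩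
  | succ n ih =>
    obtain ⟨u', h1, h2⟩ := exists_dist_split hc (x := x) (y := u) (n := n) (by omega)
    have hadj : T.Adj u' u := SimpleGraph.dist_eq_one_iff_adj.1 (by omega)
    obtain ⟨w, hw1, hw2, hw3⟩ := ih u' h1
    have t1 := tri u u' w
    have t2 := tri u w x
    have t3 := tri u w y
    have c1 := cm u u'
    have c2 := cm u x
    have c3 := cm u' x
    rcases hT.dist_eq_dist_add_one_of_adj y hadj with h | h
    · rw [cm y, cm y] at h
      by_cases huw : u' = w
      · subst huw
        have := tri x u y
        refine ⟨u, ?_, by simp, by simp⟩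
        omega
      · exfalso
        have hpos := hc.pos_dist_of_ne huw
        obtain ⟨q, hq1, hq2⟩ := exists_dist_split hc (x := u') (y := w) (n := 1) (by omega)
        have t4 := tri q w y
        have t5 := tri u' q y
        have : q = u := eq_of_dist_split hT (x := u') (y := y) (by omega) (by omega) (by omega)
        subst this
        omega
    · rw [cm y, cm y] at h
      exact ⟨w, hw1, by omega, by omega⟩

theorem dist_chain (hT : T.IsTree) {x y w w' : V}
    (hw : T.dist x w + T.dist w y = T.dist x y) (hw' : T.dist x w' + T.dist w' y = T.dist x y)
    (h : T.dist x w ≤ T.dist x w') : T.dist x w + T.dist w w' = T.dist x w' := by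
  obtain ⟨z, hz1, hz2⟩ := exists_dist_split hT.connected h
  have t1 := hT.connected.dist_triangle (u := z) (v := w') (w := y)
  have t2 := hT.connected.dist_triangle (u := x) (v := z) (w := y)
  have : w = z := eq_of_dist_split hT hw (by omega) hz1.symm
  rw [this]; omega

/-! ### Eccentricities as natural numbers -/

/-- The eccentricity of a vertex as a natural number. -/
noncomputable def ecc (T : SimpleGraph V) (v : V) : ℕ := (T.eccent v).toNat

theorem ecc_eq [Finite V] (hc : T.Connected) {v : V} {n : ℕ} (hle : ∀ u, T.dist v u ≤ n)
    (hex : ∃ u, n ≤ T.dist v u) : ecc T v = n := by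
  have hd : ∀ u, T.edist v u = (T.dist v u : ℕ∞) := fun u => (hc v u).coe_dist_eq_edist.symm
  have : T.eccent v = n := by
    apply le_antisymm
    · rw [SimpleGraph.eccent_le_iff]
      intro u; rw [hd]; exact_mod_cast hle u
    · obtain ⟨u, hu⟩ := hex
      refine le_trans ?_ (SimpleGraph.edist_le_eccent (v := u))
      rw [hd]; exact_mod_cast hu
  simp [ecc, this]

/-! ### Diametral paths -/

/-- `p 0, …, p D` is a diametral path of `T`. -/
structure IsDiametralPath (T : SimpleGraph V) (D : ℕ) (p : ℕ → V) : Prop where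
  dist_eq : ∀ i j, i ≤ j → j ≤ D → T.dist (p i) (p j) = j - i
  dist_le : ∀ u v, T.dist u v ≤ D

theorem exists_isDiametralPath [Finite V] (hc : T.Connected) :
    ∃ D p, IsDiametralPath T D p := by
  have := hc.nonempty
  obtain ⟨u, v, huv⟩ := SimpleGraph.exists_dist_eq_diam (G := T)
  obtain ⟨q, hq⟩ := hc.exists_walk_length_eq_dist u v
  have tri := fun a b c => hc.dist_triangle (u := a) (v := b) (w := c)
  have hle : ∀ i j, i ≤ j → T.dist (q.getVert i) (q.getVert j) ≤ j - i := by
    intro i j hij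
    induction j, hij using Nat.le_induction with
    | base => simp
    | succ j hj ih =>
      have h1 := tri (q.getVert i) (q.getVert j) (q.getVert (j + 1))
      have h2 : T.dist (q.getVert j) (q.getVert (j + 1)) ≤ 1 := by
        by_cases hjl : j < q.length
        · exact (SimpleGraph.dist_eq_one_iff_adj.2 (q.adj_getVert_succ hjl)).le
        · rw [q.getVert_of_length_le (by omega), q.getVert_of_length_le (by omega)]; simp
      omega
  refine ⟨T.diam, q.getVert, fun i j hij hj => ?_, fun u v =>
    SimpleGraph.dist_le_diam (SimpleGraph.connected_iff_ediam_ne_top.1 hc)⟩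
  have h1 := hle i j hij
  have h2 := hle 0 i (by omega)
  have h3 := hle j T.diam hj
  have h4 : T.dist (q.getVert 0) (q.getVert T.diam) = T.diam := by
    rw [q.getVert_zero, ← huv, ← hq, q.getVert_length, hq]
  have h5 := tri (q.getVert 0) (q.getVert i) (q.getVert T.diam)
  have h6 := tri (q.getVert i) (q.getVert j) (q.getVert T.diam)
  -- The three pieces are bounded above by their index differences and together must reach the
  -- diameter, so all bounds are equalities.
  omega

namespace IsDiametralPath

variable {D : ℕ} {p : ℕ → V}

theorem dist_eq' (hp : IsDiametralPath T D p) {i j : ℕ} (hi : i ≤ D) (hj : j ≤ D) :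
    T.dist (p i) (p j) = (i - j) + (j - i) := by
  rcases le_total i j with h | h
  · rw [hp.dist_eq i j h hj]; omega
  · rw [SimpleGraph.dist_comm, hp.dist_eq j i h hi]; omega

theorem reverse (hp : IsDiametralPath T D p) : IsDiametralPath T D (fun i => p (D - i)) where
  dist_eq i j hij hj := by
    rw [hp.dist_eq' (by omega) (by omega)]; omega
  dist_le := hp.dist_le

theorem inj (hp : IsDiametralPath T D p) {i j : ℕ} (hi : i ≤ D) (hj : j ≤ D) (h : p i = p j) :
    i = j := by
  have := hp.dist_eq' hi hj
  rw [h, SimpleGraph.dist_self] at this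
  omega

/-- Every vertex `v` has a gate `p k` on a diametral path: the distances from `v` to the path
vertices are obtained by passing through `p k`. -/
theorem exists_gate (hp : IsDiametralPath T D p) (hT : T.IsTree) (v : V) :
    ∃ k h, k ≤ D ∧ h ≤ k ∧ h + k ≤ D ∧ ∀ i ≤ D, T.dist v (p i) = h + ((i - k) + (k - i)) := by
  have hc := hT.connected
  have tri := fun a b c => hc.dist_triangle (u := a) (v := b) (w := c)
  obtain ⟨w, h1, h2, h3⟩ := exists_median hT (p 0) (p D) v
  have h0D := hp.dist_eq 0 D (by omega) le_rfl
  have a1 := hp.dist_eq 0 (T.dist (p 0) w) (by omega) (by omega)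
  have a2 := hp.dist_eq (T.dist (p 0) w) D (by omega) (by omega)
  have hw : w = p (T.dist (p 0) w) :=
    eq_of_dist_split hT h1 (by omega) (by omega)
  set k := T.dist (p 0) w
  have hk : k ≤ D := by omega
  -- Maximality of `D` towards both ends yields `h ≤ k` and `h + k ≤ D`.
  have b1 := hp.dist_le v (p D)
  have b2 := hp.dist_le v (p 0)
  have c1 : T.dist w (p 0) = k := SimpleGraph.dist_comm
  refine ⟨k, T.dist v w, hk, by omega, by omega, fun i hi => ?_⟩
  have t1 := tri v w (p i)
  have t2 : T.dist w (p i) = (k - i) + (i - k) := by rw [hw]; exact hp.dist_eq' hk hi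
  have t3 := tri v (p i) (p 0)
  have t4 := tri v (p i) (p D)
  have t5 := hp.dist_eq' hi (Nat.zero_le D)
  have t6 := hp.dist_eq' hi le_rfl
  omega

/-- A vertex of height `h'` over `p k'` has `h' ≤ min k' (D - k')`, so it is no farther from `v`
than the farther end of the path. -/
theorem ecc_of_gate [Finite V] (hp : IsDiametralPath T D p) (hT : T.IsTree) {v : V} {k h : ℕ}
    (hk : k ≤ D) (hv : ∀ i ≤ D, T.dist v (p i) = h + ((i - k) + (k - i))) :
    ecc T v = h + max k (D - k) := by
  apply ecc_eq hT.connected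
  · intro u
    obtain ⟨k', h', hk', h1, h2, hu⟩ := hp.exists_gate hT u
    have t := hT.connected.dist_triangle (u := v) (v := p k') (w := u)
    rw [hv k' hk', SimpleGraph.dist_comm (u := p k'), hu k' hk'] at t
    omega
  · rcases le_total k (D - k) with h1 | h1
    · exact ⟨p D, by rw [hv D le_rfl]; omega⟩
    · exact ⟨p 0, by rw [hv 0 (by omega)]; omega⟩

theorem ecc_apply [Finite V] (hp : IsDiametralPath T D p) (hT : T.IsTree) {i : ℕ} (hi : i ≤ D) :
    ecc T (p i) = max i (D - i) := by
  rw [hp.ecc_of_gate hT hi (h := 0) (fun j hj => by rw [hp.dist_eq' hi hj]; omega)]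
  omega

theorem ecc_le [Finite V] (hp : IsDiametralPath T D p) (hT : T.IsTree) (v : V) :
    ecc T v ≤ D := by
  obtain ⟨k, h, hk, h1, h2, hv⟩ := hp.exists_gate hT v
  rw [hp.ecc_of_gate hT hk hv]; omega

theorem le_two_mul_ecc [Finite V] (hp : IsDiametralPath T D p) (hT : T.IsTree) (v : V) :
    D ≤ 2 * ecc T v := by
  obtain ⟨k, h, hk, h1, h2, hv⟩ := hp.exists_gate hT v
  rw [hp.ecc_of_gate hT hk hv]; omega

theorem eq_of_two_mul_ecc [Finite V] (hp : IsDiametralPath T D p) (hT : T.IsTree) {v : V}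
    (he : 2 * ecc T v = D) : v = p (ecc T v) := by
  obtain ⟨k, h, hk, h1, h2, hv⟩ := hp.exists_gate hT v
  have he' := hp.ecc_of_gate hT hk hv
  have : T.dist v (p k) = 0 := by rw [hv k hk]; omega
  rw [hT.connected.dist_eq_zero_iff] at this
  rw [this, hp.ecc_apply hT hk]; congr 1; omega

/-- The gate of a vertex off the path lies at positive distance. -/
theorem gate_pos (hT : T.IsTree) {v : V} (hv : ∀ i ≤ D, v ≠ p i) {k h : ℕ}
    (hk : k ≤ D) (hg : ∀ i ≤ D, T.dist v (p i) = h + ((i - k) + (k - i))) : 0 < h := by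
  have := hT.connected.pos_dist_of_ne (hv k hk)
  rw [hg k hk] at this
  omega

theorem lt_two_mul_ecc [Finite V] (hp : IsDiametralPath T D p) (hT : T.IsTree) {v : V}
    (hv : ∀ i ≤ D, v ≠ p i) : D + 2 ≤ 2 * ecc T v := by
  obtain ⟨k, h, hk, h1, h2, hg⟩ := hp.exists_gate hT v
  have := gate_pos hT hv hk hg
  rw [hp.ecc_of_gate hT hk hg]; omega

/-! ### Distances from a vertex whose gate lies in the first half -/

section Oriented

variable [Finite V] {v : V} {k h : ℕ}

/-- A vertex `u` of smaller eccentricity that is close to `v` lies on the geodesic from `v` to the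
far end of the path. -/
theorem dist_of_close (hp : IsDiametralPath T D p) (hT : T.IsTree) (hk : 2 * k ≤ D)
    (hg : ∀ i ≤ D, T.dist v (p i) = h + ((i - k) + (k - i))) {u : V}
    (hue : ecc T u ≤ ecc T v) (hup : u ≠ p (ecc T u))
    (hd : T.dist v u ≤ ecc T v - ecc T u + 1) :
    T.dist v u = ecc T v - ecc T u ∧ T.dist u (p D) = ecc T u := by
  have hkD : k ≤ D := by omega
  have he := hp.ecc_of_gate hT hkD hg
  obtain ⟨k', h', hk', h1, h2, hu⟩ := hp.exists_gate hT u
  have he' := hp.ecc_of_gate hT hk' hu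
  obtain ⟨w, m1, m2, m3⟩ := exists_median hT v (p D) u
  have c1 : T.dist u v = T.dist v u := SimpleGraph.dist_comm
  have c2 : T.dist w v = T.dist v w := SimpleGraph.dist_comm
  have e1 := hg D le_rfl
  have e2 := hu D le_rfl
  -- Leaving the geodesic from `v` to `p D` costs twice `T.dist u w`, which exceeds the slack of 1
  -- unless `u = w`.
  have hw0 : T.dist u w = 0 := by omega
  obtain rfl := hT.connected.dist_eq_zero_iff.1 hw0
  by_contra hcon
  have e3 := hg k hkD
  have e4 := hp.dist_eq' hkD le_rfl
  have e5 := hu k hkD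
  have c3 : T.dist (p k) u = T.dist u (p k) := SimpleGraph.dist_comm
  -- If the claim fails, `p D` is not farthest from `u`, so the gate of `u` is past the middle. The
  -- geodesic from `v` has by then joined the path, so `u` is a path vertex in the second half, that
  -- is `p (ecc T u)`.
  have hh : h' = 0 := by
    rcases le_total (T.dist v u) (T.dist v (p k)) with hl | hl
    · have := dist_chain hT m1 (by omega) hl
      omega
    · have := dist_chain hT (w := p k) (w' := u) (by omega) m1 hl
      omega
  have : T.dist u (p k') = 0 := by rw [hu k' hk']; omega
  rw [hT.connected.dist_eq_zero_iff] at this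
  apply hup
  rw [this]
  congr 1
  rw [hp.ecc_apply hT hk']
  omega

/-- The ancestor is the point of the geodesic from `v` to `p D` at distance `s` from `p D`. As `D ≤
2 * s`, it does not lie past the middle, so `p D` is still farthest from it. -/
theorem exists_ancestor (hp : IsDiametralPath T D p) (hT : T.IsTree) (hk : 2 * k ≤ D)
    (hg : ∀ i ≤ D, T.dist v (p i) = h + ((i - k) + (k - i))) {s : ℕ} (hs : s ≤ ecc T v)
    (hDs : D ≤ 2 * s) :
    ∃ a, ecc T a = s ∧ T.dist v a = ecc T v - s ∧ T.dist a (p D) = s := by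
  have hkD : k ≤ D := by omega
  have he := hp.ecc_of_gate hT hkD hg
  have e1 := hg D le_rfl
  obtain ⟨a, ha1, ha2⟩ := exists_dist_split hT.connected (x := v) (y := p D)
    (n := ecc T v - s) (by omega)
  refine ⟨a, ?_, ha1, by omega⟩
  obtain ⟨k', h', hk', h1, h2, hu⟩ := hp.exists_gate hT a
  rw [hp.ecc_of_gate hT hk' hu]
  have e2 := hu D le_rfl
  have e3 := hg k hkD
  have e4 := hp.dist_eq' hkD le_rfl
  have e5 := hu k hkD
  have c3 : T.dist (p k) a = T.dist a (p k) := SimpleGraph.dist_comm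
  rcases le_total (T.dist v a) (T.dist v (p k)) with hl | hl
  · have := dist_chain hT (w := a) (w' := p k) (y := p D) (by omega) (by omega) hl
    omega
  · have := dist_chain hT (w := p k) (w' := a) (y := p D) (by omega) (by omega) hl
    omega

theorem le_dist_of_ne_ancestor (hp : IsDiametralPath T D p) (hT : T.IsTree) (hk : 2 * k ≤ D)
    (hg : ∀ i ≤ D, T.dist v (p i) = h + ((i - k) + (k - i))) {a u : V}
    (hs : ecc T u ≤ ecc T v)
    (ha1 : T.dist v a = ecc T v - ecc T u) (ha2 : T.dist a (p D) = ecc T u)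
    (hua : u ≠ a) (hup : u ≠ p (ecc T u)) :
    ecc T v - ecc T u + 2 ≤ T.dist v u := by
  by_contra hcon
  obtain ⟨h1, h2⟩ := hp.dist_of_close hT hk hg hs hup (by omega)
  have he := hp.ecc_of_gate hT (by omega) hg
  have e1 := hg D le_rfl
  exact hua (eq_of_dist_split hT (x := v) (y := p D) (by omega) (by omega) (by omega))

theorem two_le_dist (hp : IsDiametralPath T D p) (hT : T.IsTree) (hk : 2 * k ≤ D)
    (hg : ∀ i ≤ D, T.dist v (p i) = h + ((i - k) + (k - i))) {u : V}
    (hs : ecc T u = ecc T v) (huv : u ≠ v) (hup : u ≠ p (ecc T u)) : 2 ≤ T.dist v u := by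
  by_contra hcon
  obtain ⟨h1, h2⟩ := hp.dist_of_close hT hk hg hs.le hup (by omega)
  have := hT.connected.pos_dist_of_ne huv.symm
  omega

end Oriented

end IsDiametralPath

end Distances

section Weights

variable {V : Type*} {T : SimpleGraph V} {D : ℕ} {p : ℕ → V} {g : ℕ → ℝ}

theorem sum_le_card_mul {ι : Type*} (R : Finset ι) {f : ι → ℝ} {c : ℝ} (h : ∀ u ∈ R, f u ≤ c) :
    ∑ u ∈ R, f u ≤ #R * c ∧ (∑ u ∈ R, f u = #R * c ↔ ∀ u ∈ R, f u = c) := by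
  have hc : (#R : ℝ) * c = ∑ _u ∈ R, c := by simp
  rw [hc]
  exact ⟨sum_le_sum h, sum_eq_sum_iff_of_le h⟩

/-! ### Weights of pairs -/

open Classical in
/-- The contribution of an ordered pair of vertices to a Wiener-type index. -/
noncomputable def pairWeight (T : SimpleGraph V) (g : ℕ → ℝ) (u v : V) : ℝ :=
  if u = v then 0 else g (T.dist u v)

theorem pairWeight_self (u : V) : pairWeight T g u u = 0 := by simp [pairWeight]

theorem pairWeight_of_ne {u v : V} (h : u ≠ v) : pairWeight T g u v = g (T.dist u v) := by
  simp [pairWeight, h]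

theorem pairWeight_comm (u v : V) : pairWeight T g u v = pairWeight T g v u := by
  rcases eq_or_ne u v with rfl | h
  · rfl
  · rw [pairWeight_of_ne h, pairWeight_of_ne h.symm, SimpleGraph.dist_comm]

theorem two_mul_wienerTypeIndex [Fintype V] (T : SimpleGraph V) (g : ℕ → ℝ) :
    2 * wienerTypeIndex T g = ∑ u, ∑ v, pairWeight T g u v := by
  classical
  set f : Sym2 V → ℝ :=
    Sym2.lift ⟨fun u v => g (T.dist u v), fun _ _ => congrArg g SimpleGraph.dist_comm⟩ with hf
  have h1 : ∑ u, ∑ v, pairWeight T g u v =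
      ∑ q ∈ (univ : Finset (V × V)) with q.1 ≠ q.2, f s(q.1, q.2) := by
    rw [← Fintype.sum_prod_type', sum_filter]
    refine sum_congr rfl fun q _ => ?_
    by_cases h : q.1 = q.2 <;> simp [pairWeight, h, hf]
  have h2 : ∑ q ∈ (univ : Finset (V × V)) with q.1 ≠ q.2, f s(q.1, q.2) =
      ∑ e ∈ (univ : Finset (Sym2 V)) with ¬ e.IsDiag,
        ∑ q ∈ ((univ : Finset (V × V)).filter fun q => q.1 ≠ q.2) with s(q.1, q.2) = e,
          f s(q.1, q.2) :=
    (sum_fiberwise_of_maps_to (by simp) _).symm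
  have h3 : wienerTypeIndex T g = ∑ e ∈ (univ : Finset (Sym2 V)) with ¬ e.IsDiag, f e := by
    unfold wienerTypeIndex
    refine sum_congr ?_ fun _ _ => rfl
    ext; simp
  rw [h1, h2, h3, mul_sum]
  refine sum_congr rfl fun e he => ?_
  induction e with
  | _ a b =>
    have hab : a ≠ b := by simpa using he
    have : (((univ : Finset (V × V)).filter fun q => q.1 ≠ q.2).filter
        fun q => s(q.1, q.2) = s(a, b)) = {(a, b), (b, a)} := by
      ext ⟨x, y⟩
      simp only [mem_filter, mem_univ, true_and, Sym2.eq_iff, mem_insert, mem_singleton,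
        Prod.mk.injEq]
      constructor
      · exact fun h => h.2
      · rintro (⟨rfl, rfl⟩ | ⟨rfl, rfl⟩)
        · exact ⟨hab, by simp⟩
        · exact ⟨hab.symm, by simp⟩
    rw [this, sum_pair (by simp [hab]), Sym2.eq_swap (a := b)]
    ring

open Classical in
/-- The vertices `p 0, …, p D`. -/
noncomputable def pathSet (D : ℕ) (p : ℕ → V) : Finset V := (range (D + 1)).image p

theorem notMem_pathSet {v : V} : v ∉ pathSet D p ↔ ∀ i ≤ D, v ≠ p i := by
  simp only [pathSet, mem_image, mem_range, not_exists, not_and, Order.lt_add_one_iff]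
  exact forall₂_congr fun i _ => ne_comm

theorem pathSet_reverse : pathSet D (fun i => p (D - i)) = pathSet D p := by
  ext v
  simp only [pathSet, mem_image, mem_range]
  constructor
  · rintro ⟨i, hi, rfl⟩
    exact ⟨D - i, by omega, rfl⟩
  · rintro ⟨i, hi, rfl⟩
    exact ⟨D - i, by omega, by congr 1; omega⟩

variable [Fintype V]

/-- The number of vertices of eccentricity `s`. -/
noncomputable def levelCard (T : SimpleGraph V) (s : ℕ) : ℕ := #{u | ecc T u = s}

open Classical in
/-- The total weight of the pairs charged to a vertex `v` off the path with vertex set `P`. -/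
noncomputable def offWeight (T : SimpleGraph V) (g : ℕ → ℝ) (P : Finset V) (v : V) : ℝ :=
  2 * (∑ u with ecc T u < ecc T v, pairWeight T g v u +
    ∑ u ∈ P with ecc T v ≤ ecc T u, pairWeight T g v u) +
  ∑ u with u ∉ P ∧ ecc T u = ecc T v, pairWeight T g v u

-- Off-path pairs of equal eccentricity are met from both endpoints, hence carry no factor 2 in
-- `offWeight`; every other pair outside `P × P` is met once.
open Classical in
theorem sum_sum_pairWeight (P : Finset V) :
    ∑ u, ∑ v, pairWeight T g u v = ∑ u ∈ P, ∑ v ∈ P, pairWeight T g u v +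
      ∑ v with v ∉ P, offWeight T g P v := by
  classical
  set G := pairWeight T g with hG
  have hsym : ∀ u v, G u v = G v u := fun u v => pairWeight_comm u v
  set e := ecc T
  set O := univ.filter fun v => v ∉ P
  have hsplit : ∀ f : V → ℝ, ∑ u, f u = ∑ u ∈ P, f u + ∑ u ∈ O, f u := by
    intro f
    rw [← sum_filter_add_sum_filter_not univ (fun v => v ∈ P)]
    congr 1
    refine sum_congr ?_ fun _ _ => rfl
    ext; simp
  have hoff : ∀ v, offWeight T g P v = 2 * ∑ u ∈ P, G v u +
      (2 * ∑ u ∈ O with e u < e v, G v u + ∑ u ∈ O with e u = e v, G v u) := by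
    intro v
    have h1 : ∑ u with e u < e v, G v u =
        ∑ u ∈ P with e u < e v, G v u + ∑ u ∈ O with e u < e v, G v u := by
      simp only [sum_filter (fun u => e u < e v)]
      exact hsplit _
    have h2 : ∑ u ∈ P, G v u =
        ∑ u ∈ P with e u < e v, G v u + ∑ u ∈ P with e v ≤ e u, G v u := by
      rw [← sum_filter_add_sum_filter_not P (fun u => e u < e v)]
      simp only [not_lt]
    have h3 : ∑ u with u ∉ P ∧ e u = e v, G v u = ∑ u ∈ O with e u = e v, G v u := by
      rw [filter_filter]
    unfold offWeight
    rw [h1, h2, h3]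
    ring
  have hOO : ∑ v ∈ O, ∑ u ∈ O, G v u =
      ∑ v ∈ O, (2 * ∑ u ∈ O with e u < e v, G v u + ∑ u ∈ O with e u = e v, G v u) := by
    have h1 : ∑ v ∈ O, ∑ u ∈ O with e v < e u, G v u = ∑ v ∈ O, ∑ u ∈ O with e u < e v, G v u := by
      simp only [sum_filter]
      rw [sum_comm]
      simp only [hsym]
    have h2 : ∀ v, ∑ u ∈ O, G v u = ∑ u ∈ O with e u < e v, G v u +
        (∑ u ∈ O with e u = e v, G v u + ∑ u ∈ O with e v < e u, G v u) := by
      intro v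
      simp only [sum_filter]
      rw [← sum_add_distrib, ← sum_add_distrib]
      refine sum_congr rfl fun u _ => ?_
      rcases lt_trichotomy (e u) (e v) with h | h | h
      · simp [h, h.ne, h.not_gt]
      · simp [h]
      · simp [h, h.ne', h.not_gt]
    simp only [h2, sum_add_distrib, h1, ← mul_sum]
    ring
  rw [sum_congr rfl fun v _ => hoff v, sum_add_distrib, ← hOO, hsplit]
  simp only [hsplit, sum_add_distrib]
  have : ∑ u ∈ P, ∑ v ∈ O, G u v = ∑ v ∈ O, ∑ u ∈ P, G v u := by
    rw [sum_comm]; simp only [hsym]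
  rw [this, ← mul_sum]
  ring

/-! ### Bounds for the weights -/

/-- An upper bound for the total weight of the pairs formed by a vertex of eccentricity `t` and
the `n` vertices of eccentricity `s < t`. -/
noncomputable def levelBound (g : ℕ → ℝ) (D n s t : ℕ) : ℝ :=
  -- The centre of a tree of even diameter is a single vertex, both ancestor and path vertex.
  if D = 2 * s then g (t - s)
  else g (t - s) + g (s + t - D) + ((n : ℝ) - 2) * g (t - s + 2)

/-- An upper bound for `offWeight` at a vertex of eccentricity `t`, if there are `n s` vertices
of eccentricity `s` for every `s`. -/
noncomputable def offBound (g : ℕ → ℝ) (D : ℕ) (n : ℕ → ℕ) (t : ℕ) : ℝ :=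
  2 * (∑ s ∈ range t with D ≤ 2 * s, levelBound g D (n s) s t +
    -- The path has two vertices on each level `s ≥ t`. The 3 discounts the vertex itself and the
    -- two path vertices of level `t`.
    ∑ s ∈ Icc t D, (g (s + t - D) + g (s - t + 2))) + ((n t : ℝ) - 3) * g 2

namespace IsDiametralPath

variable {v : V} {k h : ℕ}

/-- Equality is analysed for `h = 1` only: then the ancestor is itself on the path, so away from the
centre the remaining vertices of the level are exactly the off-path ones. -/
theorem sum_level_le (hp : IsDiametralPath T D p) (hT : T.IsTree) (hg : StrictAntiOn g (Set.Ici 1))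
    (hk : 2 * k ≤ D) (hv : ∀ i ≤ D, T.dist v (p i) = h + ((i - k) + (k - i))) {s : ℕ}
    (hs : s < ecc T v) (hDs : D ≤ 2 * s) :
    ∑ u with ecc T u = s, pairWeight T g v u ≤ levelBound g D (levelCard T s) s (ecc T v) ∧
    (h = 1 → (∑ u with ecc T u = s, pairWeight T g v u =
        levelBound g D (levelCard T s) s (ecc T v) ↔
      ∀ u ∉ pathSet D p, ecc T u = s → T.dist v u = ecc T v - s + 2)) := by
  classical
  have he := hp.ecc_of_gate hT (by omega) hv
  have heD := hp.ecc_le hT v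
  have hne : ∀ u, ecc T u = s → v ≠ u := by
    rintro u hu rfl; omega
  have hps : ecc T (p s) = s := by rw [hp.ecc_apply hT (by omega)]; omega
  have hdps : T.dist v (p s) = s + ecc T v - D := by rw [hv s (by omega)]; omega
  rcases Nat.eq_or_lt_of_le hDs with hD | hD
  · have hL : (univ.filter fun u => ecc T u = s) = {p s} := by
      ext u
      simp only [mem_filter, mem_univ, true_and, mem_singleton]
      constructor
      · intro hu
        rw [hp.eq_of_two_mul_ecc hT (v := u) (by omega), hu]
      · rintro rfl; exact hps
    have h1 : s + ecc T v - D = ecc T v - s := by omega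
    rw [hL, sum_singleton, pairWeight_of_ne (hne _ hps), hdps, levelBound, if_pos hD, h1]
    refine ⟨le_rfl, fun _ => iff_of_true rfl fun u hu hus => ?_⟩
    have := hp.lt_two_mul_ecc hT (notMem_pathSet.1 hu)
    omega
  · obtain ⟨a, ha1, ha2, ha3⟩ := hp.exists_ancestor hT hk hv hs.le hDs
    have hap : a ≠ p s := by
      rintro rfl
      rw [hp.dist_eq s D (by omega) le_rfl] at ha3
      omega
    set L := univ.filter fun u => ecc T u = s with hL
    have haL : a ∈ L := by simp [hL, ha1]
    have hpL : p s ∈ L.erase a := by simp [hL, hps, hap.symm]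
    set R := (L.erase a).erase (p s) with hR
    have hcard : (#R : ℝ) = (levelCard T s : ℝ) - 2 := by
      have h1 : #R + 1 = #(L.erase a) := card_erase_add_one hpL
      have h2 : #(L.erase a) + 1 = #L := card_erase_add_one haL
      have : levelCard T s = #R + 2 := by
        have : levelCard T s = #L := rfl
        omega
      rw [this]; push_cast; ring
    have hle : ∀ u ∈ R, ecc T v - s + 2 ≤ T.dist v u := by
      intro u hu
      simp only [hR, hL, mem_erase, mem_filter, mem_univ, true_and] at hu
      obtain ⟨hu1, hu2, hu3⟩ := hu
      subst hu3
      exact hp.le_dist_of_ne_ancestor hT hk hv hs.le ha2 ha3 hu2 hu1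
    have hpw : ∀ u ∈ R, pairWeight T g v u = g (T.dist v u) := by
      intro u hu
      simp only [hR, hL, mem_erase, mem_filter, mem_univ, true_and] at hu
      exact pairWeight_of_ne (hne u hu.2.2)
    have hsum : ∑ u ∈ L, pairWeight T g v u =
        g (ecc T v - s) + g (s + ecc T v - D) + ∑ u ∈ R, g (T.dist v u) := by
      rw [← add_sum_erase L _ haL, ← add_sum_erase _ _ hpL, pairWeight_of_ne (hne _ ha1),
        pairWeight_of_ne (hne _ hps), ha2, hdps, ← sum_congr rfl hpw]
      ring
    obtain ⟨b1, b2⟩ := sum_le_card_mul R (f := fun u => g (T.dist v u))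
      (c := g (ecc T v - s + 2)) fun u hu =>
        hg.antitoneOn (by simp) (by have := hle u hu; simp only [Set.mem_Ici]; omega) (hle u hu)
    rw [levelBound, if_neg (by omega), hsum, ← hcard]
    refine ⟨by linarith, fun h1 => ?_⟩
    rw [add_right_inj, b2]
    have ha : a = p (D - s) := by
      have e1 := hv (D - s) (by omega)
      have e2 := hp.dist_eq (D - s) D (by omega) le_rfl
      have e3 := hv D le_rfl
      exact eq_of_dist_split hT (x := v) (y := p D) (by omega) (by omega) (by omega)
    constructor
    · intro hall u hu hus
      rw [notMem_pathSet] at hu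
      have huR : u ∈ R := by
        simp only [hR, hL, mem_erase, mem_filter, mem_univ, true_and]
        exact ⟨hu s (by omega), ha ▸ hu (D - s) (by omega), hus⟩
      have := hle u huR
      exact hg.injOn (by simp only [Set.mem_Ici]; omega) (by simp) (hall u huR)
    · intro hall u huR
      rw [hall u]
      · rw [notMem_pathSet]
        rintro i hi rfl
        simp only [hR, hL, mem_erase, mem_filter, mem_univ, true_and] at huR
        obtain ⟨hu1, hu2, hu3⟩ := huR
        rw [hp.ecc_apply hT hi] at hu3
        rcases le_total i (D - i) with hl | hl
        · apply hu2
          rw [ha]; congr 1; omega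
        · apply hu1
          congr 1; omega
      · simp only [hR, hL, mem_erase, mem_filter, mem_univ, true_and] at huR
        exact huR.2.2

/-- The path vertices in question are the pairs `p s`, `p (D - s)`, distinct because `D < 2 * ecc T
v`. They lie on opposite sides of the gate, and only the distance to `p (D - s)` depends on `h`. -/
theorem sum_path_eq (hp : IsDiametralPath T D p) (hT : T.IsTree)
    (hk : 2 * k ≤ D) (hv : ∀ i ≤ D, T.dist v (p i) = h + ((i - k) + (k - i))) (h0 : 0 < h) :
    ∑ u ∈ pathSet D p with ecc T v ≤ ecc T u, pairWeight T g v u =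
      ∑ s ∈ Icc (ecc T v) D, (g (s + ecc T v - D) + g (s - ecc T v + 2 * h)) := by
  classical
  have he := hp.ecc_of_gate hT (by omega) hv
  have heD := hp.ecc_le hT v
  have hne : ∀ i ≤ D, v ≠ p i := by
    rintro i hi rfl
    have := hv i hi
    rw [SimpleGraph.dist_self] at this
    omega
  set t := ecc T v
  have hP : (pathSet D p).filter (fun u => t ≤ ecc T u) =
      (Icc t D).image p ∪ (Icc t D).image fun s => p (D - s) := by
    ext u
    simp only [pathSet, mem_filter, mem_image, mem_range, mem_union, mem_Icc]
    constructor
    · rintro ⟨⟨i, hi, rfl⟩, hle⟩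
      rw [hp.ecc_apply hT (by omega)] at hle
      rcases le_total i (D - i) with hl | hl
      · exact Or.inr ⟨D - i, by omega, by congr 1; omega⟩
      · exact Or.inl ⟨i, by omega, rfl⟩
    · rintro (⟨i, hi, rfl⟩ | ⟨i, hi, rfl⟩)
      · exact ⟨⟨i, by omega, rfl⟩, by rw [hp.ecc_apply hT (by omega)]; omega⟩
      · exact ⟨⟨D - i, by omega, rfl⟩, by rw [hp.ecc_apply hT (by omega)]; omega⟩
  rw [hP, sum_union, sum_image, sum_image, ← sum_add_distrib]
  · refine sum_congr rfl fun s hs => ?_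
    rw [mem_Icc] at hs
    rw [pairWeight_of_ne (hne s hs.2), pairWeight_of_ne (hne (D - s) (by omega)), hv s hs.2,
      hv (D - s) (by omega)]
    congr 2 <;> omega
  · intro i hi j hj hij
    simp only [coe_Icc, Set.mem_Icc] at hi hj
    have := hp.inj (by omega) (by omega) hij
    omega
  · intro i hi j hj hij
    simp only [coe_Icc, Set.mem_Icc] at hi hj
    exact hp.inj (by omega) (by omega) hij
  · rw [disjoint_left]
    simp only [mem_image, mem_Icc]
    rintro _ ⟨i, hi, rfl⟩ ⟨j, hj, hij⟩
    have := hp.inj (by omega) (by omega) hij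
    omega

theorem sum_path_le (hp : IsDiametralPath T D p) (hT : T.IsTree) (hg : StrictAntiOn g (Set.Ici 1))
    (hk : 2 * k ≤ D) (hv : ∀ i ≤ D, T.dist v (p i) = h + ((i - k) + (k - i))) (h0 : 0 < h) :
    ∑ u ∈ pathSet D p with ecc T v ≤ ecc T u, pairWeight T g v u ≤
      ∑ s ∈ Icc (ecc T v) D, (g (s + ecc T v - D) + g (s - ecc T v + 2)) ∧
    (∑ u ∈ pathSet D p with ecc T v ≤ ecc T u, pairWeight T g v u =
      ∑ s ∈ Icc (ecc T v) D, (g (s + ecc T v - D) + g (s - ecc T v + 2)) ↔ h = 1) := by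
  rw [hp.sum_path_eq hT hk hv h0]
  have hle : ∀ s ∈ Icc (ecc T v) D, g (s + ecc T v - D) + g (s - ecc T v + 2 * h) ≤
      g (s + ecc T v - D) + g (s - ecc T v + 2) := by
    intro s _
    have := hg.antitoneOn (a := s - ecc T v + 2) (b := s - ecc T v + 2 * h) (by simp)
      (by simp only [Set.mem_Ici]; omega) (by omega)
    linarith
  refine ⟨sum_le_sum hle, ?_⟩
  rw [sum_eq_sum_iff_of_le hle]
  constructor
  · intro hall
    -- The term `s = ecc T v` reads `g (2 * h) = g 2`.
    have h1 := hall (ecc T v) (by simpa using hp.ecc_le hT v)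
    rw [add_right_inj] at h1
    have := hg.injOn (by simp only [Set.mem_Ici]; omega) (by simp) h1
    omega
  · rintro rfl s _
    rfl

open Classical in
theorem card_off_add_two (hp : IsDiametralPath T D p) (hT : T.IsTree) {t : ℕ} (hDt : D < 2 * t)
    (ht : t ≤ D) : #{u | u ∉ pathSet D p ∧ ecc T u = t} + 2 = levelCard T t := by
  set Q := univ.filter fun u => u ∉ pathSet D p ∧ ecc T u = t with hQ
  have h2 : (univ.filter fun u => ecc T u = t) = Q ∪ {p t, p (D - t)} := by
    ext u
    simp only [hQ, mem_filter, mem_univ, true_and, mem_union, mem_insert, mem_singleton]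
    constructor
    · intro hu
      by_cases huP : u ∈ pathSet D p
      · right
        simp only [pathSet, mem_image, mem_range] at huP
        obtain ⟨i, hi, rfl⟩ := huP
        rw [hp.ecc_apply hT (by omega)] at hu
        rcases le_total i (D - i) with hl | hl
        · right; congr 1; omega
        · left; congr 1; omega
      · exact Or.inl ⟨huP, hu⟩
    · rintro (hu | rfl | rfl)
      · exact hu.2
      · rw [hp.ecc_apply hT (by omega)]; omega
      · rw [hp.ecc_apply hT (by omega)]; omega
  have h3 : Disjoint Q {p t, p (D - t)} := by
    rw [disjoint_left]
    intro u hu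
    simp only [hQ, mem_filter, mem_univ, true_and, notMem_pathSet] at hu
    simp only [mem_insert, mem_singleton, not_or]
    exact ⟨hu.1 _ (by omega), hu.1 _ (by omega)⟩
  have h4 : p t ≠ p (D - t) := by
    intro h
    have := hp.inj (by omega) (by omega) h
    omega
  rw [levelCard, h2, card_union_of_disjoint h3, card_pair h4]

open Classical in
theorem sum_same_le (hp : IsDiametralPath T D p) (hT : T.IsTree) (hg : StrictAntiOn g (Set.Ici 1))
    (hk : 2 * k ≤ D) (hv : ∀ i ≤ D, T.dist v (p i) = h + ((i - k) + (k - i))) (h0 : 0 < h) :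
    ∑ u with u ∉ pathSet D p ∧ ecc T u = ecc T v, pairWeight T g v u ≤
      ((levelCard T (ecc T v) : ℝ) - 3) * g 2 ∧
    (∑ u with u ∉ pathSet D p ∧ ecc T u = ecc T v, pairWeight T g v u =
      ((levelCard T (ecc T v) : ℝ) - 3) * g 2 ↔
      ∀ u ∉ pathSet D p, u ≠ v → ecc T u = ecc T v → T.dist v u = 2) := by
  classical
  have he := hp.ecc_of_gate hT (by omega) hv
  have heD := hp.ecc_le hT v
  have hvP : v ∉ pathSet D p := by
    rw [notMem_pathSet]
    rintro i hi rfl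
    have := hv i hi
    rw [SimpleGraph.dist_self] at this
    omega
  set t := ecc T v with ht
  set Q := univ.filter fun u => u ∉ pathSet D p ∧ ecc T u = t with hQ
  have hvQ : v ∈ Q := by simp [hQ, hvP, ht]
  set R := Q.erase v with hR
  have hmem : ∀ u, u ∈ R ↔ u ≠ v ∧ u ∉ pathSet D p ∧ ecc T u = t := by
    intro u; simp [hR, hQ]
  have hcard : (#R : ℝ) = (levelCard T t : ℝ) - 3 := by
    have h1 : #R + 1 = #Q := card_erase_add_one hvQ
    have h2 : #Q + 2 = levelCard T t := hp.card_off_add_two hT (by omega) heD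
    have h5 : levelCard T t = #R + 3 := by omega
    rw [h5]; push_cast; ring
  have hle : ∀ u ∈ R, 2 ≤ T.dist v u := by
    intro u hu
    rw [hmem, notMem_pathSet] at hu
    exact hp.two_le_dist hT hk hv hu.2.2 hu.1 (hu.2.1 _ (by rw [hu.2.2]; exact heD))
  have hsum : ∑ u ∈ Q, pairWeight T g v u = ∑ u ∈ R, g (T.dist v u) := by
    rw [← add_sum_erase Q _ hvQ, pairWeight_self, zero_add]
    refine sum_congr rfl fun u hu => pairWeight_of_ne ?_
    exact ((hmem u).1 hu).1.symm
  obtain ⟨b1, b2⟩ := sum_le_card_mul R (f := fun u => g (T.dist v u)) (c := g 2) fun u hu =>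
    hg.antitoneOn (by simp) (by have := hle u hu; simp only [Set.mem_Ici]; omega) (hle u hu)
  rw [hsum, ← hcard]
  refine ⟨b1, b2.trans ⟨fun hall u hu huv hut => ?_, fun hall u hu => ?_⟩⟩
  · have huR : u ∈ R := (hmem u).2 ⟨huv, hu, hut⟩
    have := hle u huR
    exact hg.injOn (by simp only [Set.mem_Ici]; omega) (by simp) (hall u huR)
  · obtain ⟨h1, h2, h3⟩ := (hmem u).1 hu
    simp only [hall u h2 h1 h3]

end IsDiametralPath

/-- A vertex `v` off the path is adjacent to the path, and as close as possible to all the other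
vertices off the path of at most its eccentricity. -/
def IsTight (T : SimpleGraph V) (D : ℕ) (p : ℕ → V) (v : V) : Prop :=
  (∃ i ≤ D, T.Adj v (p i)) ∧
    ∀ u ∉ pathSet D p, u ≠ v → ecc T u ≤ ecc T v → T.dist v u = ecc T v - ecc T u + 2

/-! ### Bounding the total charge of an off-path vertex -/

namespace IsDiametralPath

variable {v : V}

theorem offWeight_le_of_gate {k h : ℕ} (hp : IsDiametralPath T D p) (hT : T.IsTree)
    (hg : StrictAntiOn g (Set.Ici 1)) (hk : 2 * k ≤ D)
    (hv : ∀ i ≤ D, T.dist v (p i) = h + ((i - k) + (k - i))) (h0 : 0 < h) :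
    offWeight T g (pathSet D p) v ≤ offBound g D (levelCard T) (ecc T v) ∧
    (offWeight T g (pathSet D p) v = offBound g D (levelCard T) (ecc T v) ↔
      IsTight T D p v) := by
  classical
  have hlow : ∑ u with ecc T u < ecc T v, pairWeight T g v u =
      ∑ s ∈ range (ecc T v) with D ≤ 2 * s, ∑ u with ecc T u = s, pairWeight T g v u := by
    rw [← sum_fiberwise_of_maps_to (g := ecc T)
      (t := (range (ecc T v)).filter fun s => D ≤ 2 * s)]
    · refine sum_congr rfl fun s hs => ?_
      simp only [mem_filter, mem_range] at hs
      rw [filter_filter]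
      refine sum_congr ?_ fun _ _ => rfl
      ext u
      simp only [mem_filter, mem_univ, true_and]
      exact ⟨fun h => h.2, fun h => ⟨by omega, h⟩⟩
    · intro u hu
      simp only [mem_filter, mem_univ, true_and, mem_range] at hu ⊢
      exact ⟨hu, hp.le_two_mul_ecc hT u⟩
  have hlev := fun s (hs : s ∈ (range (ecc T v)).filter fun s => D ≤ 2 * s) =>
    hp.sum_level_le hT hg hk hv (s := s) (mem_range.1 (mem_filter.1 hs).1) (mem_filter.1 hs).2
  obtain ⟨p1, p2⟩ := hp.sum_path_le hT hg hk hv h0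
  obtain ⟨s1, s2⟩ := hp.sum_same_le hT hg hk hv h0
  have l1 := sum_le_sum fun s hs => (hlev s hs).1
  have l2 := sum_eq_sum_iff_of_le fun s hs => (hlev s hs).1
  have hadj : (∃ i ≤ D, T.Adj v (p i)) ↔ h = 1 := by
    constructor
    · rintro ⟨i, hi, ha⟩
      have := hv i hi
      rw [SimpleGraph.dist_eq_one_iff_adj.2 ha] at this
      omega
    · rintro rfl
      exact ⟨k, by omega, SimpleGraph.dist_eq_one_iff_adj.1 (by rw [hv k (by omega)]; omega)⟩
  unfold offWeight offBound
  rw [hlow]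
  refine ⟨by linarith, ?_⟩
  rw [IsTight, hadj]
  constructor
  · intro heq
    -- Equality of the sums forces equality in each of the three bounds; `h = 1` comes first because
    -- the level criterion needs it.
    have h1 : h = 1 := p2.1 (by linarith)
    have h2 := l2.1 (by linarith)
    have h3 := s2.1 (by linarith)
    refine ⟨h1, fun u hu huv hle => ?_⟩
    rcases hle.eq_or_lt with h | h
    · rw [h3 u hu huv h, h, Nat.sub_self]
    · have hs : ecc T u ∈ (range (ecc T v)).filter fun s => D ≤ 2 * s := by
        simp only [mem_filter, mem_range]
        exact ⟨h, hp.le_two_mul_ecc hT u⟩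
      exact ((hlev _ hs).2 h1).1 (h2 _ hs) u hu rfl
  · rintro ⟨h1, hall⟩
    have e1 := p2.2 h1
    have e2 := s2.2 fun u hu huv h => by rw [hall u hu huv h.le, h, Nat.sub_self]
    have e3 := l2.2 fun s hs => ((hlev s hs).2 h1).2 fun u hu hus => by
      simp only [mem_filter, mem_range] at hs
      subst hus
      exact hall u hu (by rintro rfl; omega) hs.1.le
    rw [e1, e2, e3]

theorem offWeight_le (hp : IsDiametralPath T D p) (hT : T.IsTree)
    (hg : StrictAntiOn g (Set.Ici 1)) (hv : v ∉ pathSet D p) :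
    offWeight T g (pathSet D p) v ≤ offBound g D (levelCard T) (ecc T v) ∧
    (offWeight T g (pathSet D p) v = offBound g D (levelCard T) (ecc T v) ↔
      IsTight T D p v) := by
  obtain ⟨k, h, hk, h1, h2, hgate⟩ := hp.exists_gate hT v
  have h0 := gate_pos hT (notMem_pathSet.1 hv) hk hgate
  rcases le_total (2 * k) D with hkD | hkD
  · exact hp.offWeight_le_of_gate hT hg hkD hgate h0
  -- Reversing the path moves the gate into the first half.
  · have := hp.reverse.offWeight_le_of_gate hT hg (k := D - k) (h := h) (v := v) (by omega)
      (fun i hi => by rw [hgate _ (by omega)]; omega) h0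
    rw [pathSet_reverse] at this
    refine ⟨this.1, this.2.trans ?_⟩
    unfold IsTight
    rw [pathSet_reverse]
    refine and_congr_left fun _ => ⟨?_, ?_⟩
    · rintro ⟨i, hi, ha⟩
      exact ⟨D - i, by omega, ha⟩
    · rintro ⟨i, hi, ha⟩
      refine ⟨D - i, by omega, ?_⟩
      have : D - (D - i) = i := by omega
      simpa only [this] using ha

end IsDiametralPath

/-- An upper bound for twice a Wiener-type index in terms of the diameter `D` and the eccentric
sequence `S`. -/
noncomputable def indexBound (g : ℕ → ℝ) (D : ℕ) (S : List ℕ) : ℝ :=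
  ∑ i ∈ range (D + 1), ∑ j ∈ range (D + 1), (if i = j then 0 else g ((i - j) + (j - i))) +
    -- Sum over off-path vertices, written as the sum over all vertices minus that over the path, so
    -- that only `D` and `S` appear.
    ((S.map (offBound g D fun s => S.count s)).sum -
      ∑ i ∈ range (D + 1), offBound g D (fun s => S.count s) (max i (D - i)))

theorem coe_eccentricSequence (T : SimpleGraph V) :
    (eccentricSequence T : Multiset ℕ) = (univ : Finset V).val.map (ecc T) := by
  rw [eccentricSequence, Multiset.sort_eq]; rfl

theorem count_eccentricSequence (T : SimpleGraph V) (s : ℕ) :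
    (eccentricSequence T).count s = levelCard T s := by
  classical
  rw [← Multiset.coe_count, coe_eccentricSequence, Multiset.count_map, levelCard, Finset.card_def,
    Finset.filter_val]
  simp only [eq_comm]

theorem sum_map_eccentricSequence (T : SimpleGraph V) (f : ℕ → ℝ) :
    ((eccentricSequence T).map f).sum = ∑ v, f (ecc T v) := by
  rw [← Multiset.sum_coe, ← Multiset.map_coe, coe_eccentricSequence, Multiset.map_map]
  rfl

theorem IsDiametralPath.two_mul_wienerTypeIndex_le (hp : IsDiametralPath T D p) (hT : T.IsTree)
    (hg : StrictAntiOn g (Set.Ici 1)) :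
    2 * wienerTypeIndex T g ≤ indexBound g D (eccentricSequence T) ∧
    (2 * wienerTypeIndex T g = indexBound g D (eccentricSequence T) ↔
      ∀ v ∉ pathSet D p, IsTight T D p v) := by
  classical
  have hinj : Set.InjOn p (range (D + 1)) := by
    intro i hi j hj hij
    simp only [coe_range, Set.mem_Iio] at hi hj
    exact hp.inj (by omega) (by omega) hij
  have hpath : ∑ u ∈ pathSet D p, ∑ v ∈ pathSet D p, pairWeight T g u v =
      ∑ i ∈ range (D + 1), ∑ j ∈ range (D + 1), (if i = j then 0 else g ((i - j) + (j - i))) := by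
    rw [pathSet, sum_image hinj]
    refine sum_congr rfl fun i hi => ?_
    rw [sum_image hinj]
    refine sum_congr rfl fun j hj => ?_
    simp only [mem_range] at hi hj
    split_ifs with h
    · rw [h, pairWeight_self]
    · rw [pairWeight_of_ne fun hij => h (hp.inj (by omega) (by omega) hij),
        hp.dist_eq' (by omega) (by omega)]
  have hcount : (fun s => (eccentricSequence T).count s) = levelCard T :=
    funext (count_eccentricSequence T)
  have hoff : ∑ v with v ∉ pathSet D p, offBound g D (levelCard T) (ecc T v) =
      ((eccentricSequence T).map (offBound g D (levelCard T))).sum -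
        ∑ i ∈ range (D + 1), offBound g D (levelCard T) (max i (D - i)) := by
    rw [sum_map_eccentricSequence, eq_sub_iff_add_eq,
      ← sum_filter_not_add_sum_filter univ (fun v => v ∈ pathSet D p)]
    congr 1
    have : (univ.filter fun v => v ∈ pathSet D p) = pathSet D p := by ext; simp
    rw [this, pathSet, sum_image hinj]
    refine sum_congr rfl fun i hi => ?_
    rw [mem_range] at hi
    rw [hp.ecc_apply hT (by omega)]
  have hle : ∀ v ∈ univ.filter (fun v => v ∉ pathSet D p), offWeight T g (pathSet D p) v ≤
      offBound g D (levelCard T) (ecc T v) := fun v hv =>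
    (hp.offWeight_le hT hg (mem_filter.1 hv).2).1
  rw [two_mul_wienerTypeIndex, sum_sum_pairWeight (pathSet D p), indexBound, hcount, hpath, ← hoff]
  refine ⟨by have := sum_le_sum hle; linarith, ?_⟩
  rw [add_right_inj, sum_eq_sum_iff_of_le hle]
  simp only [mem_filter, mem_univ, true_and]
  exact forall₂_congr fun v hv => (hp.offWeight_le hT hg hv).2

end Weights

/-! ### Criteria for distance lower bounds and for trees -/

section Potential

variable {V : Type*} {G : SimpleGraph V}

theorem le_add_dist (hc : G.Connected) {f : V → ℕ} (hf : ∀ u v, G.Adj u v → f v ≤ f u + 1)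
    (u v : V) : f v ≤ f u + G.dist u v := by
  have : ∀ {u v : V} (q : G.Walk u v), f v ≤ f u + q.length := by
    intro u v q
    induction q with
    | nil => simp
    | cons h q ih =>
      have := hf _ _ h
      rw [SimpleGraph.Walk.length_cons]
      omega
  obtain ⟨q, hq⟩ := hc.exists_walk_length_eq_dist u v
  rw [← hq]
  exact this q

/-- A connected finite graph in which each edge joins a vertex other than `root` to its parent is
a tree. -/
theorem isTree_of_parent [Finite V] (hc : G.Connected) (root : V) (par : V → V)
    (h : ∀ u v, G.Adj u v → (v ≠ root ∧ u = par v) ∨ (u ≠ root ∧ v = par u)) : G.IsTree := by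
  rw [SimpleGraph.isTree_iff_connected_and_card]
  refine ⟨hc, le_antisymm ?_ hc.card_vert_le_card_edgeSet_add_one⟩
  -- Each edge is named by its child, so there are fewer edges than vertices.
  have hsub : G.edgeSet ⊆ (fun v => s(par v, v)) '' {root}ᶜ := by
    intro e he
    induction e with
    | _ u v =>
      rw [SimpleGraph.mem_edgeSet] at he
      rcases h u v he with ⟨h1, rfl⟩ | ⟨h1, rfl⟩
      · exact ⟨v, h1, rfl⟩
      · exact ⟨u, h1, Sym2.eq_swap⟩
  have h1 : G.edgeSet.ncard ≤ ({root}ᶜ : Set V).ncard :=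
    (Set.ncard_le_ncard hsub (Set.toFinite _)).trans (Set.ncard_image_le (Set.toFinite _))
  have h2 := Set.ncard_add_ncard_compl ({root} : Set V)
  rw [Set.ncard_singleton] at h2
  have h3 : Nat.card G.edgeSet = G.edgeSet.ncard := rfl
  omega

end Potential

/-! ### The standard tree -/

section Standard

variable {r : ℕ} {m : List ℕ}

/-- The vertex `v_i` of the path in the standard tree. -/
def standardPath (r : ℕ) (m : List ℕ) (i : ℕ) : StandardTreeVertex r m :=
  .inl ⟨min i (r + m.length), by omega⟩

/-- The index of the path vertex that is equal or adjacent to a given vertex. -/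
def foot : StandardTreeVertex r m → ℕ
  | .inl a => a.val
  | .inr q => m.length - q.1.val

/-- The distance of a vertex of the standard tree from the path. -/
def height : StandardTreeVertex r m → ℕ
  | .inl _ => 0
  | .inr _ => 1

theorem standardPath_foot_inl (a : Fin (r + m.length + 1)) :
    standardPath r m (foot (.inl a : StandardTreeVertex r m)) = .inl a := by
  have : min a.val (r + m.length) = a.val := by omega
  simp [standardPath, foot, this]

theorem adj_standardPath_succ {i : ℕ} (hi : i < r + m.length) :
    (standardTree r m).Adj (standardPath r m i) (standardPath r m (i + 1)) :=
  Or.inl (show min i (r + m.length) + 1 = min (i + 1) (r + m.length) by omega)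

theorem adj_inr_standardPath (q : Σ i : Fin m.length, Fin (m.get i - 2)) :
    (standardTree r m).Adj (.inr q) (standardPath r m (m.length - q.1.val)) :=
  show min (m.length - q.1.val) (r + m.length) = m.length - q.1.val by omega

theorem standardTree_connected : (standardTree r m).Connected := by
  have hpath : ∀ i ≤ r + m.length,
      (standardTree r m).Reachable (standardPath r m i) (standardPath r m 0) := by
    intro i hi
    induction i with
    | zero => exact SimpleGraph.Reachable.refl _
    | succ i ih => exact (adj_standardPath_succ (by omega)).symm.reachable.trans (ih (by omega))
  have hall : ∀ x, (standardTree r m).Reachable x (standardPath r m 0) := by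
    rintro (a | q)
    · rw [← standardPath_foot_inl a]
      exact hpath _ (by simp only [foot]; omega)
    · exact (adj_inr_standardPath q).reachable.trans (hpath _ (by omega))
  have : Nonempty (StandardTreeVertex r m) := ⟨standardPath r m 0⟩
  exact ⟨fun x y => (hall x).trans (hall y).symm⟩

theorem standardTree_isTree : (standardTree r m).IsTree := by
  refine isTree_of_parent standardTree_connected (standardPath r m 0)
    (fun x => match x with
      | .inl a => standardPath r m (a.val - 1)
      | .inr q => standardPath r m (m.length - q.1.val)) ?_
  have key : ∀ a b : Fin (r + m.length + 1), a.val + 1 = b.val →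
      (Sum.inl b : StandardTreeVertex r m) ≠ standardPath r m 0 ∧
        (Sum.inl a : StandardTreeVertex r m) = standardPath r m (b.val - 1) := by
    intro a b h
    constructor
    · intro h'
      have := congrArg Fin.val (Sum.inl_injective h')
      simp only at this
      omega
    · rw [← standardPath_foot_inl a]
      congr 1
      simp only [foot]; omega
  have key' : ∀ (a : Fin (r + m.length + 1)) (q : Σ i : Fin m.length, Fin (m.get i - 2)),
      a.val = m.length - q.1.val →
      (Sum.inl a : StandardTreeVertex r m) = standardPath r m (m.length - q.1.val) := by
    intro a q h
    rw [← standardPath_foot_inl a]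
    congr 1
  rintro (a | q) (b | q') h
  · rcases h with h | h
    · exact Or.inl (key a b h)
    · exact Or.inr (key b a h)
  · exact Or.inl ⟨by simp [standardPath], key' a q' h⟩
  · exact Or.inr ⟨by simp [standardPath], key' b q h⟩
  · exact h.elim

theorem dist_standardTree {x y : StandardTreeVertex r m} (hxy : x ≠ y) :
    (standardTree r m).dist x y =
      height x + height y + ((foot x - foot y) + (foot y - foot x)) := by
  classical
  have hc : (standardTree r m).Connected := standardTree_connected
  have tri := fun a b c => hc.dist_triangle (u := a) (v := b) (w := c)
  apply le_antisymm
  · have hpath : ∀ i j, i ≤ j → j ≤ r + m.length →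
        (standardTree r m).dist (standardPath r m i) (standardPath r m j) ≤ j - i := by
      intro i j hij
      induction j, hij using Nat.le_induction with
      | base => simp
      | succ j hj ih =>
        intro hj'
        have h1 := tri (standardPath r m i) (standardPath r m j) (standardPath r m (j + 1))
        have h2 := SimpleGraph.dist_eq_one_iff_adj.2
          (adj_standardPath_succ (r := r) (m := m) (i := j) (by omega))
        have := ih (by omega)
        omega
    have hfoot : ∀ z : StandardTreeVertex r m, foot z ≤ r + m.length ∧
        (standardTree r m).dist z (standardPath r m (foot z)) ≤ height z := by
      rintro (a | q)
      · rw [standardPath_foot_inl]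
        simp only [foot, SimpleGraph.dist_self]
        omega
      · exact ⟨by simp only [foot]; omega,
          (SimpleGraph.dist_eq_one_iff_adj.2 (adj_inr_standardPath q)).le⟩
    obtain ⟨x1, x2⟩ := hfoot x
    obtain ⟨y1, y2⟩ := hfoot y
    have t1 := tri x (standardPath r m (foot x)) y
    have t2 := tri (standardPath r m (foot x)) (standardPath r m (foot y)) y
    rw [SimpleGraph.dist_comm] at y2
    rcases le_total (foot x) (foot y) with hl | hl
    · have := hpath _ _ hl y1
      omega
    · have := hpath _ _ hl x1
      rw [SimpleGraph.dist_comm] at this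
      omega
  -- The formula grows by at most one along edges. It is reset to 0 at `x`, where it would give 2
  -- for a pendent vertex.
  · have := le_add_dist hc (f := fun z => if z = x then 0 else
      height x + height z + ((foot x - foot z) + (foot z - foot x))) ?_ x y
    · simpa only [if_neg hxy.symm, if_true, zero_add] using this
    · intro u v huv
      have hne := huv.ne
      have step : height x + height v + ((foot x - foot v) + (foot v - foot x)) ≤
          height x + height u + ((foot x - foot u) + (foot u - foot x)) + 1 := by
        rcases u with a | q <;> rcases v with b | q'
        · have h : a.val + 1 = b.val ∨ b.val + 1 = a.val := huv
          simp only [height, foot]; omega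
        · have h : a.val = m.length - q'.1.val := huv
          simp only [height, foot]; omega
        · have h : b.val = m.length - q.1.val := huv
          simp only [height, foot]; omega
        · exact huv.elim
      by_cases hv : v = x
      · simp [hv]
      · by_cases hu : u = x
        · subst hu
          simp only [if_neg hv, if_true]
          rcases u with a | q <;> rcases v with b | q'
          · have h : a.val + 1 = b.val ∨ b.val + 1 = a.val := huv
            simp only [height, foot]; omega
          · have h : a.val = m.length - q'.1.val := huv
            simp only [height, foot]; omega
          · have h : b.val = m.length - q.1.val := huv
            simp only [height, foot]; omega
          · exact huv.elim
        · simpa only [if_neg hv, if_neg hu] using step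

theorem foot_standardPath {i : ℕ} (hi : i ≤ r + m.length) : foot (standardPath r m i) = i := by
  simp only [foot, standardPath]; omega

theorem standardPath_isDiametralPath (hr : 0 < r) (hm : m.length ≤ r) :
    IsDiametralPath (standardTree r m) (r + m.length) (standardPath r m) where
  dist_eq i j hij hj := by
    rcases hij.eq_or_lt with rfl | h
    · simp
    · have hne : standardPath r m i ≠ standardPath r m j := by
        intro h'
        have := congrArg foot h'
        rw [foot_standardPath (by omega), foot_standardPath hj] at this
        omega
      rw [dist_standardTree hne, foot_standardPath (by omega), foot_standardPath hj]
      simp only [height, standardPath]; omega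
  dist_le x y := by
    rcases eq_or_ne x y with rfl | h
    · simp
    · rw [dist_standardTree h]
      rcases x with a | q <;> rcases y with b | q' <;> simp only [height, foot] <;> omega

theorem notMem_pathSet_standardPath {x : StandardTreeVertex r m}
    (hx : x ∉ pathSet (r + m.length) (standardPath r m)) : ∃ q, x = .inr q := by
  rw [notMem_pathSet] at hx
  rcases x with a | q
  · exact (hx a (by omega) (standardPath_foot_inl a).symm).elim
  · exact ⟨q, rfl⟩

theorem ecc_standardTree_inl (hr : 0 < r) (hm : m.length ≤ r) (a : Fin (r + m.length + 1)) :
    ecc (standardTree r m) (.inl a) = max a.val (r + m.length - a.val) := by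
  rw [← standardPath_foot_inl a]
  exact (standardPath_isDiametralPath hr hm).ecc_apply standardTree_isTree (Nat.lt_succ_iff.1 a.2)

theorem ecc_standardTree_inr (hr : 0 < r) (hm : m.length ≤ r)
    (q : Σ i : Fin m.length, Fin (m.get i - 2)) :
    ecc (standardTree r m) (.inr q) = r + 1 + q.1.val := by
  rw [(standardPath_isDiametralPath hr hm).ecc_of_gate standardTree_isTree
    (k := m.length - q.1.val) (h := 1) (by omega)]
  · omega
  · intro i hi
    rw [dist_standardTree (by simp [standardPath]), foot_standardPath hi]
    simp only [height, foot, standardPath]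
    omega

/-- All pendent vertices hang on the same half, so their feet differ by exactly as much as their
eccentricities. -/
theorem isTight_standardPath (hr : 0 < r) (hm : m.length ≤ r) {x : StandardTreeVertex r m}
    (hx : x ∉ pathSet (r + m.length) (standardPath r m)) :
    IsTight (standardTree r m) (r + m.length) (standardPath r m) x := by
  obtain ⟨q, rfl⟩ := notMem_pathSet_standardPath hx
  refine ⟨⟨_, by omega, adj_inr_standardPath q⟩, fun y hy hyx hle => ?_⟩
  obtain ⟨q', rfl⟩ := notMem_pathSet_standardPath hy
  rw [ecc_standardTree_inr hr hm, ecc_standardTree_inr hr hm] at *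
  rw [dist_standardTree hyx.symm]
  simp only [height, foot]
  omega

end Standard

theorem IsDiametralPath.gate_of_isTight {V : Type*} {T : SimpleGraph V} {D : ℕ}
    {p : ℕ → V} (hp : IsDiametralPath T D p) (hT : T.IsTree) {v : V}
    (hv : v ∉ pathSet D p) (ht : IsTight T D p v) :
    ∃ k ≤ D, T.Adj v (p k) ∧ ∀ i ≤ D, T.dist v (p i) = 1 + ((i - k) + (k - i)) := by
  obtain ⟨k, h, hk, -, -, hg⟩ := hp.exists_gate hT v
  have h0 := gate_pos hT (notMem_pathSet.1 hv) hk hg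
  obtain ⟨i, hi, ha⟩ := ht.1
  have h1 := hg i hi
  rw [SimpleGraph.dist_eq_one_iff_adj.2 ha] at h1
  have h2 : i = k := by omega
  have h3 : h = 1 := by omega
  subst h2 h3
  exact ⟨i, hk, ha, hg⟩

/-! ### The shorthand of an eccentric sequence -/

section Shorthand

variable {V : Type*} [Fintype V] {T : SimpleGraph V} {D : ℕ} {p : ℕ → V} {r : ℕ} {m : List ℕ}

theorem mem_eccentricSequence {s : ℕ} : s ∈ eccentricSequence T ↔ ∃ v, ecc T v = s := by
  rw [← Multiset.mem_coe, coe_eccentricSequence]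
  simp

namespace IsDiametralPath

theorem mem_eccentricSequence_iff (hp : IsDiametralPath T D p) (hT : T.IsTree) {s : ℕ} :
    s ∈ eccentricSequence T ↔ (D + 1) / 2 ≤ s ∧ s ≤ D := by
  rw [mem_eccentricSequence]
  constructor
  · rintro ⟨v, rfl⟩
    have := hp.ecc_le hT v
    have := hp.le_two_mul_ecc hT v
    omega
  · intro h
    exact ⟨p s, by rw [hp.ecc_apply hT h.2]; omega⟩

/-- The eccentricities that occur fill the interval from `(D + 1) / 2` to `D`, so the shorthand
determines the diameter. -/
theorem of_hasShorthand (hp : IsDiametralPath T D p) (hT : T.IsTree)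
    (h : HasShorthand (eccentricSequence T) r m) :
    r = (D + 1) / 2 ∧ r + m.length = D ∧ ∀ i : Fin m.length, m.get i = levelCard T (r + 1 + i) := by
  set S := eccentricSequence T with hS
  have hmem : ∀ s, s ∈ S ↔ (D + 1) / 2 ≤ s ∧ s ≤ D := fun s => hp.mem_eccentricSequence_iff hT
  have hsort : S.Pairwise (· ≤ ·) := Multiset.pairwise_sort _ _
  obtain ⟨h1, h2⟩ := h
  have hr : r = (D + 1) / 2 := by
    obtain ⟨l, hl⟩ : ∃ l, S = r :: l := by
      rcases hS' : S with _ | ⟨a, l⟩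
      · rw [hS'] at h1; simp at h1
      · rw [hS'] at h1
        simp only [List.head?_cons, Option.some.injEq] at h1
        exact ⟨l, by rw [h1]⟩
    have ha : (D + 1) / 2 ∈ S := (hmem _).2 ⟨le_rfl, by omega⟩
    have hb : r ∈ S := by rw [hl]; simp
    have hb' := (hmem r).1 hb
    rw [hl] at ha hsort
    rcases List.mem_cons.1 ha with h | h
    · exact h.symm
    · have := (List.pairwise_cons.1 hsort).1 _ h
      omega
  have hdedup : S.dedup = List.range' r (D - r + 1) := by
    refine List.Perm.eq_of_pairwise' (r := (· ≤ ·)) (hsort.sublist (List.dedup_sublist S))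
      ((List.pairwise_lt_range' (s := r) (n := D - r + 1)).imp le_of_lt) ?_
    rw [List.perm_ext_iff_of_nodup (List.nodup_dedup S) List.nodup_range']
    intro s
    rw [List.mem_dedup, hmem, List.mem_range'_1]
    omega
  rw [hdedup, List.range'_succ, List.tail_cons] at h2
  have hlen : m.length = D - r := by rw [← h2]; simp
  refine ⟨hr, by omega, fun i => ?_⟩
  subst h2
  simp [count_eccentricSequence, S]

end IsDiametralPath

/-- The vertices of a tree with eccentric sequence `(r; m)` correspond to those of the standard
tree, in such a way that a diametral path corresponds to the path `v_0, …, v_{r+l-1}`. -/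
theorem IsDiametralPath.exists_equiv (hp : IsDiametralPath T D p) (hT : T.IsTree)
    (hr : r = (D + 1) / 2) (hD : r + m.length = D)
    (hm : ∀ i : Fin m.length, m.get i = levelCard T (r + 1 + i)) :
    ∃ φ : StandardTreeVertex r m ≃ V, (∀ a, φ (.inl a) = p a) ∧
      ∀ q, φ (.inr q) ∉ pathSet D p ∧ ecc T (φ (.inr q)) = r + 1 + q.1 := by
  classical
  have hcard : ∀ i : Fin m.length,
      Fintype.card {v // v ∉ pathSet D p ∧ ecc T v = r + 1 + i} = m.get i - 2 := by
    intro i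
    have := hp.card_off_add_two hT (t := r + 1 + i) (by omega) (by omega)
    rw [Fintype.card_subtype, hm i, ← this, Nat.add_sub_cancel]
  let e := fun i : Fin m.length => (Fintype.equivFinOfCardEq (hcard i)).symm
  let f : StandardTreeVertex r m → V := Sum.elim (fun a => p a) fun q => (e q.1 q.2).1
  have hoff : ∀ q : Σ i : Fin m.length, Fin (m.get i - 2),
      (e q.1 q.2).1 ∉ pathSet D p ∧ ecc T (e q.1 q.2).1 = r + 1 + q.1 := fun q => (e q.1 q.2).2
  have hinj : Function.Injective f := by
    rintro (a | q) (b | q') h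
    · have := hp.inj (by omega) (by omega) h
      rw [Fin.ext this]
    · exact (notMem_pathSet.1 (hoff q').1 a (by omega) h.symm).elim
    · exact (notMem_pathSet.1 (hoff q).1 b (by omega) h).elim
    · have h' : (e q.1 q.2).1 = (e q'.1 q'.2).1 := h
      have h1 := (hoff q).2
      rw [h', (hoff q').2] at h1
      obtain ⟨i, j⟩ := q
      obtain ⟨i', j'⟩ := q'
      have : i = i' := Fin.ext (by simpa using h1.symm)
      subst this
      have hj : j = j' := (e i).injective (Subtype.ext h')
      rw [hj]
  have hsurj : Function.Surjective f := by
    intro v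
    by_cases hv : v ∈ pathSet D p
    · simp only [pathSet, mem_image, mem_range] at hv
      obtain ⟨i, hi, rfl⟩ := hv
      exact ⟨.inl ⟨i, by omega⟩, rfl⟩
    · have h1 := hp.lt_two_mul_ecc hT (notMem_pathSet.1 hv)
      have h2 := hp.ecc_le hT v
      let i : Fin m.length := ⟨ecc T v - (r + 1), by omega⟩
      have hi : ecc T v = r + 1 + i := by simp only [i]; omega
      exact ⟨.inr ⟨i, (e i).symm ⟨v, hv, hi⟩⟩, by simp [f]⟩
  exact ⟨Equiv.ofBijective f ⟨hinj, hsurj⟩, fun a => rfl, fun q => hoff q⟩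

/-- Two tight vertices off a diametral path are not strictly on different sides of its middle. -/
theorem IsDiametralPath.not_opposite (hp : IsDiametralPath T D p) (hT : T.IsTree) {u v : V}
    (hu : u ∉ pathSet D p) (hv : v ∉ pathSet D p) (htu : IsTight T D p u) (htv : IsTight T D p v)
    {k k' : ℕ} (hk : 2 * k < D) (hk' : D < 2 * k') (hkD : k' ≤ D)
    (hgv : ∀ i ≤ D, T.dist v (p i) = 1 + ((i - k) + (k - i)))
    (hgu : ∀ i ≤ D, T.dist u (p i) = 1 + ((i - k') + (k' - i))) : False := by
  have hev := hp.ecc_of_gate hT (by omega) hgv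
  have heu := hp.ecc_of_gate hT hkD hgu
  have huv : u ≠ v := by
    rintro rfl
    have h1 := hgv k (by omega)
    have h2 := hgu k (by omega)
    omega
  have hadj : T.Adj v (p k) :=
    SimpleGraph.dist_eq_one_iff_adj.1 (by rw [hgv k (by omega)]; omega)
  have h1 := hgu k (by omega)
  have h2 := hgu (k + 1) (by omega)
  have h3 := hp.dist_eq k (k + 1) (by omega) (by omega)
  have c1 : T.dist (p k) u = T.dist u (p k) := SimpleGraph.dist_comm
  have c2 : T.dist (p (k + 1)) u = T.dist u (p (k + 1)) := SimpleGraph.dist_comm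
  have c3 : T.dist v u = T.dist u v := SimpleGraph.dist_comm
  have h4 : T.dist (p k) v = 1 := SimpleGraph.dist_eq_one_iff_adj.2 hadj.symm
  -- Otherwise `v` would be the first step from `p k` towards `u`, which is `p (k + 1)`.
  have hd : T.dist u v = T.dist u (p k) + 1 := by
    rcases hT.dist_eq_dist_add_one_of_adj u hadj with h | h
    · exact h
    · have : v = p (k + 1) :=
        eq_of_dist_split hT (x := p k) (y := u) (by omega) (by omega) (by omega)
      exact (notMem_pathSet.1 hv (k + 1) (by omega) this).elim
  -- Here `T.dist u v = k' - k + 2`, while tightness would make it `|D - k - k'| + 2`, forcing a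
  -- gate at the middle.
  rcases le_total (ecc T u) (ecc T v) with hl | hl
  · have := htv.2 u hu huv hl
    omega
  · have := htu.2 v hv huv.symm hl
    omega

/-- If all vertices off a diametral path are tight, then the path can be oriented in such a way
that they are attached to its first half. -/
theorem IsDiametralPath.exists_oriented (hp : IsDiametralPath T D p) (hT : T.IsTree)
    (ht : ∀ v ∉ pathSet D p, IsTight T D p v) :
    ∃ p', IsDiametralPath T D p' ∧
      ∀ v ∉ pathSet D p', T.Adj v (p' (D + 1 - ecc T v)) := by
  -- One vertex hanging strictly before the middle keeps all others from hanging strictly after it;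
  -- if there is none, the reversed path works. The gate index is `D + 1 - ecc T v` because the
  -- height is 1.
  by_cases hex : ∃ v ∉ pathSet D p, ∃ k, 2 * k < D ∧
      ∀ i ≤ D, T.dist v (p i) = 1 + ((i - k) + (k - i))
  · obtain ⟨v, hv, k, hk, hgv⟩ := hex
    refine ⟨p, hp, fun u hu => ?_⟩
    obtain ⟨k', hk', ha, hgu⟩ := hp.gate_of_isTight hT hu (ht u hu)
    have hle : ¬ D < 2 * k' := fun h =>
      hp.not_opposite hT hu hv (ht u hu) (ht v hv) hk h hk' hgv hgu
    have : D + 1 - ecc T u = k' := by rw [hp.ecc_of_gate hT hk' hgu]; omega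
    rwa [this]
  · push Not at hex
    refine ⟨fun i => p (D - i), hp.reverse, fun u hu => ?_⟩
    rw [pathSet_reverse] at hu
    obtain ⟨k', hk', ha, hgu⟩ := hp.gate_of_isTight hT hu (ht u hu)
    have hle : ¬ 2 * k' < D := fun h => by
      obtain ⟨i, hi, h'⟩ := hex u hu k' h
      exact h' (hgu i hi)
    have : D - (D + 1 - ecc T u) = k' := by rw [hp.ecc_of_gate hT hk' hgu]; omega
    simpa only [this] using ha

/-- It is enough that edges of the standard tree go to edges of `T`: a tree is minimal among
connected graphs, so a connected spanning subgraph is all of it. -/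
theorem IsDiametralPath.nonempty_iso_of_isTight (hp : IsDiametralPath T D p) (hT : T.IsTree)
    (hr : r = (D + 1) / 2) (hD : r + m.length = D)
    (hm : ∀ i : Fin m.length, m.get i = levelCard T (r + 1 + i))
    (ht : ∀ v ∉ pathSet D p, IsTight T D p v) : Nonempty (T ≃g standardTree r m) := by
  obtain ⟨p', hp', hadj⟩ := hp.exists_oriented hT ht
  obtain ⟨φ, hφ1, hφ2⟩ := hp'.exists_equiv hT hr hD hm
  have hiso := SimpleGraph.Iso.comap φ T
  have hpath : ∀ i < D, T.Adj (p' i) (p' (i + 1)) := fun i hi =>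
    SimpleGraph.dist_eq_one_iff_adj.1 (by rw [hp'.dist_eq i (i + 1) (by omega) (by omega)]; omega)
  have hleaf : ∀ (a : Fin (r + m.length + 1)) q, a.val = m.length - q.1.val →
      T.Adj (φ (.inr q)) (φ (.inl a)) := by
    intro a q h
    have h1 := hadj _ (hφ2 q).1
    rw [(hφ2 q).2] at h1
    rw [hφ1, h]
    convert h1 using 2
    omega
  have hle : standardTree r m ≤ T.comap φ := by
    rintro (a | q) (b | q') h
    · change T.Adj (φ (.inl a)) (φ (.inl b))
      rw [hφ1, hφ1]
      rcases h with h | h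
      · rw [← h]; exact hpath _ (by omega)
      · rw [← h]; exact (hpath _ (by omega)).symm
    · exact (hleaf a q' h).symm
    · exact hleaf b q h
    · exact h.elim
  have hmin := SimpleGraph.isTree_iff_minimal_connected.1 (hiso.isTree_iff.2 hT)
  have heq : T.comap φ = standardTree r m := le_antisymm (hmin.2 standardTree_connected hle) hle
  rw [heq] at hiso
  exact ⟨hiso.symm⟩

/-- The standard tree has the prescribed eccentric sequence. -/
theorem IsDiametralPath.eccentricSequence_standardTree (hp : IsDiametralPath T D p)
    (hT : T.IsTree) (hr0 : 0 < r) (hr : r = (D + 1) / 2) (hD : r + m.length = D)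
    (hm : ∀ i : Fin m.length, m.get i = levelCard T (r + 1 + i)) :
    eccentricSequence (standardTree r m) = eccentricSequence T := by
  obtain ⟨φ, hφ1, hφ2⟩ := hp.exists_equiv hT hr hD hm
  have hecc : ∀ x, ecc (standardTree r m) x = ecc T (φ x) := by
    rintro (a | q)
    · rw [ecc_standardTree_inl hr0 (by omega), hφ1, hp.ecc_apply hT (by omega)]
      omega
    · rw [ecc_standardTree_inr hr0 (by omega), (hφ2 q).2]
  have : (univ : Finset (StandardTreeVertex r m)).val.map (ecc (standardTree r m)) =
      (univ : Finset V).val.map (ecc T) := by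
    rw [← Finset.map_univ_equiv φ, Finset.map_val, Multiset.map_map]
    exact Multiset.map_congr rfl fun x _ => hecc x
  exact congrArg (Multiset.sort · (· ≤ ·)) this

end Shorthand

/-! ### Isomorphism invariance of Wiener-type indices -/

section Iso

theorem dist_le_of_iso {V W : Type*} {G : SimpleGraph V} {H : SimpleGraph W} (hG : G.Connected)
    (φ : G ≃g H) (u v : V) : H.dist (φ u) (φ v) ≤ G.dist u v := by
  obtain ⟨q, hq⟩ := hG.exists_walk_length_eq_dist u v
  rw [← hq, ← SimpleGraph.Walk.length_map φ.toHom q]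
  exact SimpleGraph.dist_le _

theorem wienerTypeIndex_eq_of_iso {V W : Type*} [Fintype V] [Fintype W] {G : SimpleGraph V}
    {H : SimpleGraph W} (hG : G.Connected) (φ : G ≃g H) (g : ℕ → ℝ) :
    wienerTypeIndex G g = wienerTypeIndex H g := by
  have hH : H.Connected := φ.connected_iff.1 hG
  have hd : ∀ u v, G.dist u v = H.dist (φ u) (φ v) := by
    intro u v
    refine le_antisymm ?_ (dist_le_of_iso hG φ u v)
    have := dist_le_of_iso hH φ.symm (φ u) (φ v)
    rwa [φ.symm_apply_apply, φ.symm_apply_apply] at this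
  have hw : ∀ u v, pairWeight G g u v = pairWeight H g (φ u) (φ v) := by
    intro u v
    rcases eq_or_ne u v with rfl | h
    · rw [pairWeight_self, pairWeight_self]
    · rw [pairWeight_of_ne h, pairWeight_of_ne (φ.injective.ne h), hd]
  have : 2 * wienerTypeIndex G g = 2 * wienerTypeIndex H g := by
    rw [two_mul_wienerTypeIndex, two_mul_wienerTypeIndex]
    refine Fintype.sum_equiv φ.toEquiv _ _ fun u => ?_
    exact Fintype.sum_equiv φ.toEquiv _ _ fun v => hw u v
  linarith

end Iso

/-! ### Extremality of the standard tree -/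

section Main

variable {S : List ℕ} {r : ℕ} {m : List ℕ}

theorem pos_and_length_le_of_hasShorthand (hS : IsTreeEccentricSequence S)
    (hrm : HasShorthand S r m) : 0 < r ∧ m.length ≤ r := by
  obtain ⟨hpos, n, T, hT, rfl⟩ := hS
  obtain ⟨D, p, hp⟩ := exists_isDiametralPath hT.connected
  obtain ⟨hr, hD, -⟩ := hp.of_hasShorthand hT hrm
  have := hpos r ((hp.mem_eccentricSequence_iff hT).2 (by omega))
  omega

theorem eccentricSequence_standardTree (hS : IsTreeEccentricSequence S)
    (hrm : HasShorthand S r m) : eccentricSequence (standardTree r m) = S := by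
  have hr0 := (pos_and_length_le_of_hasShorthand hS hrm).1
  obtain ⟨-, n, T, hT, rfl⟩ := hS
  obtain ⟨D, p, hp⟩ := exists_isDiametralPath hT.connected
  obtain ⟨hr, hD, hm⟩ := hp.of_hasShorthand hT hrm
  exact hp.eccentricSequence_standardTree hT hr0 hr hD hm

/-- For strictly decreasing `g`, the standard tree is the unique maximiser of `W(T; g)` among the
trees with the same eccentric sequence. -/
theorem wienerTypeIndex_le_standardTree (hS : IsTreeEccentricSequence S)
    (hrm : HasShorthand S r m) {g : ℕ → ℝ} (hg : StrictAntiOn g (Set.Ici 1)) {V : Type*}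
    [Fintype V] {T : SimpleGraph V} (hT : T.IsTree) (hTS : eccentricSequence T = S) :
    wienerTypeIndex T g ≤ wienerTypeIndex (standardTree r m) g ∧
      (wienerTypeIndex T g = wienerTypeIndex (standardTree r m) g ↔
        Nonempty (T ≃g standardTree r m)) := by
  obtain ⟨hr0, hml⟩ := pos_and_length_le_of_hasShorthand hS hrm
  obtain ⟨D, p, hp⟩ := exists_isDiametralPath hT.connected
  have hrm' : HasShorthand (eccentricSequence T) r m := hTS ▸ hrm
  obtain ⟨hr, hD, hm⟩ := hp.of_hasShorthand hT hrm'
  have hstd := ((standardPath_isDiametralPath hr0 hml).two_mul_wienerTypeIndex_le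
    standardTree_isTree hg).2.2 fun x hx => isTight_standardPath hr0 hml hx
  rw [eccentricSequence_standardTree hS hrm] at hstd
  -- Both trees have diameter `D`, so the bound attained by the standard tree is the bound for `T`.
  replace hstd := hstd.trans (congrArg (indexBound g · S) hD)
  obtain ⟨h1, h2⟩ := hp.two_mul_wienerTypeIndex_le hT hg
  rw [hTS, ← hstd] at h1 h2
  refine ⟨by linarith, fun h => ?_, fun ⟨φ⟩ => wienerTypeIndex_eq_of_iso hT.connected φ g⟩
  exact hp.nonempty_iso_of_isTight hT hr hD hm (h2.1 (by rw [h]))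

/-- Monotonicity is asked from 1 on because the value at `d = 0` is the default 0. -/
theorem strictAntiOn_rpow {lam : ℝ} (hlam : lam < 0) :
    StrictAntiOn (fun d : ℕ => (d : ℝ) ^ lam) (Set.Ici 1) := by
  intro a ha b _ hab
  have ha' : 0 < a := ha
  exact Real.rpow_lt_rpow_of_neg (by exact_mod_cast ha') (by exact_mod_cast hab) hlam

theorem strictAntiOn_one_div : StrictAntiOn (fun d : ℕ => 1 / (d : ℝ)) (Set.Ici 1) := by
  intro a ha b _ hab
  have ha' : 0 < a := ha
  exact one_div_lt_one_div_of_lt (by exact_mod_cast ha') (by exact_mod_cast hab)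

end Main

end EccentricTree

theorem corollary2 (S : List ℕ) (hS : IsTreeEccentricSequence S)
    (r : ℕ) (m : List ℕ) (hrm : HasShorthand S r m) :
    ((standardTree r m).IsTree ∧ eccentricSequence (standardTree r m) = S) ∧
    (∀ lam : ℝ, lam < 0 →
      ∀ (V : Type*) [Fintype V] (T : SimpleGraph V), T.IsTree → eccentricSequence T = S →
        generalisedWienerIndex lam T ≤ generalisedWienerIndex lam (standardTree r m) ∧
        (generalisedWienerIndex lam T = generalisedWienerIndex lam (standardTree r m) ↔
          Nonempty (T ≃g standardTree r m))) ∧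
    (∀ (V : Type*) [Fintype V] (T : SimpleGraph V), T.IsTree → eccentricSequence T = S →
        hararyIndex T ≤ hararyIndex (standardTree r m) ∧
        (hararyIndex T = hararyIndex (standardTree r m) ↔
          Nonempty (T ≃g standardTree r m))) := by
  refine ⟨⟨EccentricTree.standardTree_isTree,
    EccentricTree.eccentricSequence_standardTree hS hrm⟩, ?_, ?_⟩
  · intro lam hlam V _ T hT hTS
    exact EccentricTree.wienerTypeIndex_le_standardTree hS hrm
      (EccentricTree.strictAntiOn_rpow hlam) hT hTS
  · intro V _ T hT hTS
    exact EccentricTree.wienerTypeIndex_le_standardTree hS hrm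
      EccentricTree.strictAntiOn_one_div hT hTS
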